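/- A strictly increasing real sequence $(x_j)_{j\in\mathbb{Z}}$ is called a Riesz-basis sequence if the functions $t\mapsto e^{-ix_jt}$, $j\in\mathbb{Z}$, form a Riesz basis of $L_2[-\pi,\pi]$: every $h\in L_2[-\pi,\pi]$ has a unique expansion $h=\sum_j a_je^{-ix_j\,\cdot}$ with $\sum_j|a_j|^2<\infty$, and there is $B>0$ with $B^{-1}(\sum_j|c_j|^2)^{1/2}\le\|\sum_jc_je^{-ix_j\,\cdot}\|_{L_2[-\pi,\pi]}\le B(\sum_j|c_j|^2)^{1/2}$ for every square-summable $(c_j)$. Let $PW_\pi$ be the space of all continuous $f\in L_2(\mathbb{R})$ whose Fourier transform $u\mapsto\int f(t)e^{-iut}\,dt$ (in the $L_2$ sense) vanishes almost everywhere outside $[-\pi,\pi]$. Let $(x_j)_{j\in\mathbb{Z}}$ be a Riesz-basis sequence. Then for every $0<\lambda\le 1$ and $f\in PW_\pi$ there is a unique square-summable complex sequence $(a_j)_{j\in\mathbb{Z}}$ with $\sum_{j}a_je^{-\lambda(x_k-x_j)^2}=f(x_k)$ for all $k\in\mathbb{Z}$. The series $$I_\lambda(f)(t):=\sum_{j\in\mathbb{Z}}a_je^{-\lambda(t-x_j)^2},\qquad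 t\in\mathbb{R},$$ converges for every $t$, the function $I_\lambda(f)$ belongs to $C(\mathbb{R})\cap L_2(\mathbb{R})$ and satisfies $I_\lambda(f)(x_k)=f(x_k)$ for all $k$. The map $I_\lambda:PW_\pi\to L_2(\mathbb{R})$ is linear, and the family $\{I_\lambda:0<\lambda\le1\}$ is uniformly bounded: there is a constant $C$, depending only on $(x_j)$, such that $$\|I_\lambda(f)\|_{L_2(\mathbb{R})}\le C\,\|f\|_{L_2(\mathbb{R})}\qquad\text{for all }f\in PW_\pi,\ 0<\lambda\le1.$$ -/

import Mathlib

open MeasureTheory FourierTransform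
open scoped ENNReal

noncomputable section

namespace GaussInterp

/-- A Riesz basis of a complex Hilbert space: every vector has a unique expansion with
square-summable coefficients, and the norm of `∑ c j • φ j` is comparable to the `ℓ²` norm of `c`
for every square-summable `c`. -/
structure IsRieszBasis {ι H : Type*} [NormedAddCommGroup H] [InnerProductSpace ℂ H]
    (φ : ι → H) : Prop where
  existsUnique_expansion : ∀ h : H,
    ∃! a : lp (fun _ : ι => ℂ) 2, HasSum (fun j => a j • φ j) h
  bounds : ∃ B : ℝ, 0 < B ∧ ∀ c : lp (fun _ : ι => ℂ) 2,
    Summable (fun j => c j • φ j) ∧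
    B⁻¹ * ‖c‖ ≤ ‖∑' j, c j • φ j‖ ∧ ‖∑' j, c j • φ j‖ ≤ B * ‖c‖

/-- The Hilbert space `L₂[-π, π]`. -/
abbrev L2Band : Type := Lp ℂ 2 (volume.restrict (Set.Icc (-Real.pi) Real.pi))

theorem memLp_exp (s : ℝ) :
    MemLp (fun t : ℝ => Complex.exp (-(Complex.I * s * t))) 2
      (volume.restrict (Set.Icc (-Real.pi) Real.pi)) := by
  refine MemLp.of_bound (C := 1) ?_ (Filter.Eventually.of_forall fun t => ?_)
  · exact (by fun_prop : Continuous
      (fun t : ℝ => Complex.exp (-(Complex.I * s * t)))).aestronglyMeasurable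
  · rw [Complex.norm_exp]
    simp

/-- The exponential `t ↦ e^{-i s t}` as an element of `L₂[-π, π]`. -/
def expBand (s : ℝ) : L2Band := (memLp_exp s).toLp _

/-- Riesz-basis sequences: strictly increasing real sequences `(x j)`, `j ∈ ℤ`, whose
exponentials `e^{-i (x j) t}` form a Riesz basis of `L₂[-π, π]`. -/
structure IsRieszBasisSequence (x : ℤ → ℝ) : Prop where
  lt_succ : ∀ j : ℤ, x j < x (j + 1)
  isRieszBasis : IsRieszBasis (fun j : ℤ => expBand (x j))

/-- The `L₂` Fourier transform in the normalization `∫ g(t) e^{-iut} dt`. Mathlib's `𝓕` is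
normalized as `∫ g(t) e^{-2πiut} dt`, whence the rescaling of the argument. -/
def fourierL2 (g : Lp ℂ 2 (volume : Measure ℝ)) (u : ℝ) : ℂ :=
  (𝓕 g : Lp ℂ 2 (volume : Measure ℝ)) (u / (2 * Real.pi))

theorem quasi_scale :
    Measure.QuasiMeasurePreserving (fun u : ℝ => u / (2 * Real.pi)) volume volume := by
  refine ⟨by fun_prop, ?_⟩
  have h : (2 * Real.pi)⁻¹ ≠ 0 := inv_ne_zero Real.two_pi_pos.ne'
  simp only [div_eq_mul_inv]
  rw [Real.map_volume_mul_right h]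
  exact Measure.smul_absolutelyContinuous

theorem fourierL2_add (g h : Lp ℂ 2 (volume : Measure ℝ)) :
    fourierL2 (g + h) =ᵐ[volume] fun u => fourierL2 g u + fourierL2 h u := by
  have := quasi_scale.ae (Lp.coeFn_add (𝓕 g) (𝓕 h))
  rw [← FourierTransform.fourier_add] at this
  exact this

theorem fourierL2_smul (c : ℂ) (g : Lp ℂ 2 (volume : Measure ℝ)) :
    fourierL2 (c • g) =ᵐ[volume] fun u => c * fourierL2 g u := by
  have := quasi_scale.ae (Lp.coeFn_smul c (𝓕 g))
  rw [← FourierTransform.fourier_smul] at this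
  exact this

/-- The Paley–Wiener space `PW_π`: square-integrable functions on `ℝ` whose Fourier transform
vanishes almost everywhere outside `[-π, π]`, each represented by its continuous version. -/
def PW : Submodule ℂ (ℝ → ℂ) where
  carrier := {f | Continuous f ∧ ∃ hf : MemLp f 2 (volume : Measure ℝ),
    ∀ᵐ u : ℝ, u ∉ Set.Icc (-Real.pi) Real.pi → fourierL2 (hf.toLp f) u = 0}
  zero_mem' := by
    refine ⟨continuous_zero, MemLp.zero, ?_⟩
    have h := fourierL2_smul 0 0
    rw [zero_smul] at h
    have e : (MemLp.zero : MemLp (0 : ℝ → ℂ) 2 (volume : Measure ℝ)).toLp 0 = 0 :=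
      MemLp.toLp_zero _
    filter_upwards [h] with u hu _
    rw [e, hu, zero_mul]
  add_mem' := by
    rintro f g ⟨hfc, hf, hf0⟩ ⟨hgc, hg, hg0⟩
    refine ⟨hfc.add hgc, hf.add hg, ?_⟩
    filter_upwards [hf0, hg0, fourierL2_add (hf.toLp f) (hg.toLp g)] with u h1 h2 h3 hu
    rw [MemLp.toLp_add hf hg, h3, h1 hu, h2 hu, add_zero]
  smul_mem' := by
    rintro c f ⟨hfc, hf, hf0⟩
    refine ⟨hfc.const_smul c, hf.const_smul c, ?_⟩
    filter_upwards [hf0, fourierL2_smul c (hf.toLp f)] with u h1 h2 hu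
    rw [MemLp.toLp_const_smul c hf, h2, h1 hu, mul_zero]

/-- The Gaussian `g_lam(t) = e^{-lam t²}`. -/
def gaussian (lam t : ℝ) : ℝ := Real.exp (-lam * t ^ 2)

/-- `a` is a square-summable sequence with `∑ j, a j * g_lam (x k - x j) = f (x k)` for all `k`. -/
def IsInterpCoeff (lam : ℝ) (x : ℤ → ℝ) (f : ℝ → ℂ) (a : ℤ → ℂ) : Prop :=
  Memℓp a 2 ∧ ∀ k : ℤ, HasSum (fun j : ℤ => a j * (gaussian lam (x k - x j) : ℂ)) (f (x k))

open Classical in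
/-- The coefficient sequence of the Gaussian interpolant (`0` if there is none). -/
def interpCoeff (lam : ℝ) (x : ℤ → ℝ) (f : ℝ → ℂ) : ℤ → ℂ :=
  if h : ∃ a, IsInterpCoeff lam x f a then h.choose else 0

/-- The Gaussian interpolant `I_lam(f)` at the data sites `x j`. -/
def gaussInterpolant (lam : ℝ) (x : ℤ → ℝ) (f : ℝ → ℂ) (t : ℝ) : ℂ :=
  ∑' j : ℤ, interpCoeff lam x f j * (gaussian lam (t - x j) : ℂ)

end GaussInterp

end

noncomputable section

/-! Write `f = (2π)⁻¹ ∫ q(u) e^{iut} du` with `q ∈ L²` supported in the band `[-π, π]`. Up to the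
factor `√(4πλ)`, the Gaussian `g_λ` is the Fourier integral of the weight `e^{-βu²}`, `β = (4λ)⁻¹`.
Hence the Gaussian matrix is the Gram matrix `S*S` of the exponentials in `L²(e^{-βu²} du)`, where
`S` is their synthesis operator. With `T` the synthesis operator on the band, sampling is `q ↦ T*q`,
and the interpolation equations become `S*S b = T*q`.

The Riesz property bounds `T` below, and the weight is at least `m = e^{-βπ²}` on the band; so `S`
is bounded below and `S*S` is invertible (`bijective_adjoint_comp_self`). This bound degenerates as
`λ → 0`, so uniformity needs more.

Let `R` be the synthesis operator for the weight outside the band. Averaging the Bessel inequality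
over translates of the band extends it to a fixed Gaussian weight (`exists_gaussMeasure_bessel`).
Since `e^{-βu²}` is at most `m` off the band, this gives `‖R a‖² ≤ mK‖a‖²` with `K` independent of
`λ`. Splitting `S*S b = T*ψ + R*R b`, with `ψ` the weighted sum on the band, and using `m‖b‖ ≤
B³‖q‖`, the powers of `m` cancel in the estimates of `ψ` and `R b` (`energy_estimate`). Plancherel's
theorem turns this into the bound on the line. -/

namespace GaussInterp


/-! ### Fourier integrals, Plancherel and Paley–Wiener -/

/-- On `L¹ ∩ L²` the `L²` inverse Fourier transform is given by the Fourier integral. -/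
theorem fourierInv_toLp_ae_eq {g : ℝ → ℂ} (h1 : Integrable g) (h2 : MemLp g 2 volume) :
    ((𝓕⁻ (h2.toLp g) : Lp ℂ 2 (volume : Measure ℝ)) : ℝ → ℂ) =ᵐ[volume] 𝓕⁻ g := by
  have hcont : Continuous (𝓕⁻ g) :=
    VectorFourier.fourierIntegral_continuous Real.continuous_fourierChar (by fun_prop) h1
  refine ae_eq_of_integral_contDiff_smul_eq
    ((Lp.memLp _).locallyIntegrable one_le_two) hcont.locallyIntegrable fun φ hφ hφs => ?_
  have hc : HasCompactSupport (Complex.ofRealCLM ∘ φ) := hφs.comp_left rfl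
  have hd : ContDiff ℝ (⊤ : ℕ∞) (Complex.ofRealCLM ∘ φ) := Complex.ofRealCLM.contDiff.comp hφ
  set Φ : SchwartzMap ℝ ℂ := hc.toSchwartzMap hd with hΦ
  have hΦa : ∀ t, Φ t = (φ t : ℂ) := fun t => by simp [hΦ]
  -- Both transforms are tested against `Φ`: by the distributional definition here, and by Fubini's
  -- theorem below, each pairing equals that of `g` with `𝓕⁻ Φ`.
  have e1 := congrArg (fun T => T Φ) (Lp.fourierInv_toTemperedDistribution_eq (h2.toLp g))
  simp only [TemperedDistribution.fourierInv_apply, Lp.toTemperedDistribution_apply] at e1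
  have e2 : ∫ t, (𝓕⁻ Φ) t • (h2.toLp g : Lp ℂ 2 volume) t = ∫ t, (𝓕⁻ Φ) t • g t := by
    refine integral_congr_ae ?_
    filter_upwards [h2.coeFn_toLp] with t ht
    rw [ht]
  rw [e2] at e1
  simp only [← Complex.coe_smul, ← hΦa]
  rw [← e1]
  have := VectorFourier.integral_fourierIntegral_smul_eq_flip (μ := (volume : Measure ℝ))
    (ν := (volume : Measure ℝ)) (L := -innerₗ ℝ)
      Real.continuous_fourierChar (by fun_prop) (Φ.integrable (μ := volume)) h1
  rw [SchwartzMap.fourierInv_coe]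
  have h3 : (-innerₗ ℝ).flip = -innerₗ ℝ := by
    ext; simp
  rw [h3] at this
  exact this

/-- The Fourier integral `∫ g(u) e^{iut} du`. -/
def invFourier (g : ℝ → ℂ) (t : ℝ) : ℂ := ∫ u, g u * Complex.exp (Complex.I * u * t)

theorem fourierInv_comp_mul (g : ℝ → ℂ) (t : ℝ) :
    𝓕⁻ (fun v => g (2 * Real.pi * v)) t = (2 * Real.pi : ℂ)⁻¹ * invFourier g t := by
  rw [Real.fourierInv_eq']
  have := Measure.integral_comp_mul_left
    (fun u : ℝ => g u * Complex.exp (Complex.I * u * t)) (2 * Real.pi)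
  rw [abs_of_pos (by positivity)] at this
  rw [← Complex.coe_smul] at this
  push_cast [smul_eq_mul] at this
  rw [invFourier, ← this]
  refine integral_congr_ae (.of_forall fun v => ?_)
  simp
  rw [mul_comm]
  congr 2
  ring

theorem eLpNorm_comp_mul {c : ℝ} (hc : 0 < c) (g : ℝ → ℂ) :
    eLpNorm (fun v => g (c * v)) 2 volume = ENNReal.ofReal (c ^ (-(1/2) : ℝ)) * eLpNorm g 2 volume := by
  have hme : MeasurableEmbedding (fun v : ℝ => c * v) :=
    (Homeomorph.mulLeft₀ c hc.ne').measurableEmbedding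
  have := hme.eLpNorm_map_measure (μ := volume) (g := g) (p := 2)
  rw [Real.map_volume_mul_left hc.ne', eLpNorm_smul_measure_of_ne_top (by simp)] at this
  change _ = eLpNorm (fun v => g (c * v)) 2 volume at this
  rw [← this, smul_eq_mul, ENNReal.ofReal_rpow_of_nonneg (by positivity) (by norm_num),
    abs_of_pos (by positivity), Real.rpow_neg hc.le, ← Real.inv_rpow hc.le]
  norm_num

theorem memLp_comp_mul {c : ℝ} (hc : 0 < c) {g : ℝ → ℂ} (hg : MemLp g 2 volume) :
    MemLp (fun v => g (c * v)) 2 volume := by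
  refine ⟨hg.1.comp_quasiMeasurePreserving ⟨by fun_prop, ?_⟩, ?_⟩
  · rw [Real.map_volume_mul_left hc.ne']
    exact Measure.smul_absolutelyContinuous
  · rw [eLpNorm_comp_mul hc]
    exact ENNReal.mul_lt_top ENNReal.ofReal_lt_top hg.2

theorem continuous_invFourier {g : ℝ → ℂ} (h1 : Integrable g) : Continuous (invFourier g) := by
  refine continuous_of_dominated (bound := fun u => ‖g u‖) (fun t => ?_) (fun t => ?_) h1.norm ?_
  · exact h1.1.mul (by fun_prop : Continuous _).aestronglyMeasurable
  · refine .of_forall fun u => ?_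
    rw [norm_mul, Complex.norm_exp]
    simp
  · exact .of_forall fun u => by fun_prop

/-- Plancherel's theorem for the Fourier integral on `L¹ ∩ L²`. -/
theorem eLpNorm_invFourier {g : ℝ → ℂ} (h1 : Integrable g) (h2 : MemLp g 2 volume) :
    eLpNorm (invFourier g) 2 volume = ENNReal.ofReal √(2 * Real.pi) * eLpNorm g 2 volume := by
  have hp : 0 < 2 * Real.pi := Real.two_pi_pos
  have i1 : Integrable (fun v => g (2 * Real.pi * v)) := h1.comp_mul_left' hp.ne'
  have i2 := memLp_comp_mul hp h2
  have e : invFourier g = (2 * Real.pi : ℂ) • 𝓕⁻ (fun v => g (2 * Real.pi * v)) := by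
    ext t
    rw [Pi.smul_apply, fourierInv_comp_mul, smul_eq_mul, mul_inv_cancel_left₀]
    exact_mod_cast hp.ne'
  rw [e, eLpNorm_const_smul, eLpNorm_congr_ae (fourierInv_toLp_ae_eq i1 i2).symm, ← Lp.enorm_def]
  have : ‖(𝓕⁻ (i2.toLp _) : Lp ℂ 2 (volume : Measure ℝ))‖ₑ = ‖i2.toLp _‖ₑ := by
    rw [← ofReal_norm, ← ofReal_norm, ← Lp.norm_fourier_eq, FourierTransform.fourier_fourierInv_eq]
  rw [this, Lp.enorm_toLp, eLpNorm_comp_mul hp, ← mul_assoc]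
  congr 1
  have : ‖(2 * Real.pi : ℂ)‖ₑ = ENNReal.ofReal (2 * Real.pi) := by
    rw [← ofReal_norm]
    norm_cast
    rw [Real.norm_of_nonneg hp.le]
  rw [this, ← ENNReal.ofReal_mul hp.le]
  congr 1
  nth_rw 1 [← Real.rpow_one (2 * Real.pi)]
  rw [← Real.rpow_add hp, Real.sqrt_eq_rpow]
  norm_num

/-- Paley–Wiener functions are Fourier integrals of square-integrable functions on `[-π, π]`. -/
theorem exists_invFourier_of_mem_PW {f : ℝ → ℂ} (hf : f ∈ PW) :
    ∃ q : ℝ → ℂ, Integrable q ∧ MemLp q 2 volume ∧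
      (∀ u ∉ Set.Icc (-Real.pi) Real.pi, q u = 0) ∧
      ∀ t, f t = (2 * Real.pi : ℂ)⁻¹ * invFourier q t := by
  obtain ⟨hfc, hf2, h0⟩ := hf
  have hp : 0 < 2 * Real.pi := Real.two_pi_pos
  set g : Lp ℂ 2 (volume : Measure ℝ) := 𝓕 (hf2.toLp f) with hg
  set q : ℝ → ℂ := (Set.Icc (-Real.pi) Real.pi).indicator (fourierL2 (hf2.toLp f)) with hq
  have hscale : fourierL2 (hf2.toLp f) = fun u => g ((2 * Real.pi)⁻¹ * u) := by
    ext u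
    rw [fourierL2, ← hg, div_eq_inv_mul]
  have q2 : MemLp q 2 volume := by
    rw [hq, hscale]
    exact (memLp_comp_mul (inv_pos.2 hp) (Lp.memLp g)).indicator measurableSet_Icc
  have q0 : ∀ u ∉ Set.Icc (-Real.pi) Real.pi, q u = 0 := fun u hu => Set.indicator_of_notMem hu _
  have q1 : Integrable q := by
    rw [← integrableOn_iff_integrable_of_support_subset
      (s := Set.Icc (-Real.pi) Real.pi) (fun u hu => by_contra fun h => hu (q0 u h))]
    exact (q2.restrict _).integrable one_le_two
  have hqe : q =ᵐ[volume] fourierL2 (hf2.toLp f) := by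
    filter_upwards [h0] with u hu
    by_cases h : u ∈ Set.Icc (-Real.pi) Real.pi
    · exact Set.indicator_of_mem h _
    · rw [q0 u h, hu h]
  have hqm : Measure.QuasiMeasurePreserving (fun u : ℝ => 2 * Real.pi * u) volume volume := by
    refine ⟨by fun_prop, ?_⟩
    rw [Real.map_volume_mul_left hp.ne']
    exact Measure.smul_absolutelyContinuous
  have hG : (fun v => q (2 * Real.pi * v)) =ᵐ[volume] g := by
    filter_upwards [hqm.ae hqe] with v hv
    rw [hv, hscale]
    simp only
    rw [inv_mul_cancel_left₀ hp.ne']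
  have i1 : Integrable (fun v => q (2 * Real.pi * v)) := q1.comp_mul_left' hp.ne'
  have i2 := memLp_comp_mul hp q2
  have hL : i2.toLp _ = g := by
    rw [← Lp.toLp_coeFn g (Lp.memLp g)]
    exact MemLp.toLp_congr _ _ hG
  have hfe : f =ᵐ[volume] 𝓕⁻ (fun v => q (2 * Real.pi * v)) := by
    have := fourierInv_toLp_ae_eq i1 i2
    rw [hL, hg, FourierTransform.fourierInv_fourier_eq] at this
    exact hf2.coeFn_toLp.symm.trans this
  refine ⟨q, q1, q2, q0, fun t => ?_⟩
  have hcont : Continuous (fun t => ((2 * Real.pi)⁻¹ : ℂ) * invFourier q t) :=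
    continuous_const.mul (continuous_invFourier q1)
  -- Both sides are continuous, so almost everywhere equality holds at every point; sampling at the
  -- `x k` needs this.
  have := (hfc.ae_eq_iff_eq (μ := volume) hcont).1 (by
    filter_upwards [hfe] with t ht
    rw [ht, fourierInv_comp_mul])
  exact congrFun this t

/-- This fixes the weight parameter `(4 * lam)⁻¹` used throughout: small `lam` means a sharply
concentrated weight on the frequency side. -/
theorem invFourier_gaussian {lam : ℝ} (hl : 0 < lam) (t : ℝ) :
    invFourier (fun u => (gaussian (4 * lam)⁻¹ u : ℂ)) t
      = (√(4 * Real.pi * lam) * gaussian lam t : ℝ) := by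
  have hb : 0 < (4 * lam)⁻¹ := by positivity
  have := fourierIntegral_gaussian (b := ((4 * lam)⁻¹ : ℝ)) (by simpa using hl) (t : ℂ)
  have hc : ((Real.pi : ℂ) / ((4 * lam)⁻¹ : ℝ)) ^ (1 / 2 : ℂ) = (√(4 * Real.pi * lam) : ℝ) := by
    rw [Real.sqrt_eq_rpow, Complex.ofReal_cpow (by positivity)]
    push_cast
    congr 1
    field_simp
  have hg : Complex.exp (-(t : ℂ) ^ 2 / (4 * ((4 * lam)⁻¹ : ℝ))) = (gaussian lam t : ℝ) := by
    rw [gaussian, Complex.ofReal_exp]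
    push_cast
    congr 1
    field_simp
  rw [hc, hg] at this
  rw [Complex.ofReal_mul, ← this]
  refine integral_congr_ae (.of_forall fun u => ?_)
  simp only [gaussian]
  push_cast
  rw [mul_comm]
  congr 2
  ring


/-! ### Bessel sequences and synthesis operators -/

/-- The space of square-summable complex sequences indexed by `ℤ`. -/
abbrev EllTwo : Type := lp (fun _ : ℤ => ℂ) 2

theorem norm_sq_eq_tsum (a : EllTwo) : ‖a‖ ^ 2 = ∑' j, ‖a j‖ ^ 2 := by
  have := lp.norm_rpow_eq_tsum (p := 2) (by simp) a
  simpa using this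

theorem summable_norm_sq (a : EllTwo) : Summable fun j => ‖a j‖ ^ 2 := by
  have := (lp.hasSum_norm (p := 2) (by simp) a).summable
  simpa using this

section Synthesis

variable {H : Type*} [NormedAddCommGroup H] [InnerProductSpace ℂ H] [CompleteSpace H]
  {φ : ℤ → H} {K : ℝ}

theorem summable_smul_of_bessel
    (hK : ∀ (s : Finset ℤ) (c : ℤ → ℂ), ‖∑ j ∈ s, c j • φ j‖ ^ 2 ≤ K * ∑ j ∈ s, ‖c j‖ ^ 2)
    (a : EllTwo) : Summable fun j => a j • φ j := by
  rw [summable_iff_vanishing_norm]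
  intro ε hε
  -- The denominator `|K| + 1` avoids any assumption on the sign of `K`.
  obtain ⟨s, hs⟩ := summable_iff_vanishing_norm.1 (summable_norm_sq a) (ε ^ 2 / (|K| + 1))
    (by positivity)
  refine ⟨s, fun t ht => ?_⟩
  have h1 := hs t ht
  rw [Real.norm_of_nonneg (Finset.sum_nonneg fun j _ => by positivity),
    lt_div_iff₀ (by positivity)] at h1
  have h0 : 0 ≤ ∑ j ∈ t, ‖a j‖ ^ 2 := Finset.sum_nonneg fun j _ => by positivity
  have h2 := hK t a
  refine lt_of_pow_lt_pow_left₀ 2 hε.le ?_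
  nlinarith [le_abs_self K]

/-- The synthesis operator `a ↦ ∑ a j • φ j` of a Bessel sequence. -/
def synthesis (φ : ℤ → H) (K : ℝ)
    (hK : ∀ (s : Finset ℤ) (c : ℤ → ℂ), ‖∑ j ∈ s, c j • φ j‖ ^ 2 ≤ K * ∑ j ∈ s, ‖c j‖ ^ 2) :
    EllTwo →L[ℂ] H :=
  LinearMap.mkContinuous
    { toFun := fun a => ∑' j, a j • φ j
      map_add' := fun a b => by
        rw [← (summable_smul_of_bessel hK a).tsum_add (summable_smul_of_bessel hK b)]
        simp [add_smul]
      map_smul' := fun c a => by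
        rw [RingHom.id_apply, ← (summable_smul_of_bessel hK a).tsum_const_smul c]
        simp [smul_smul] }
    √K fun a => by
      have h : ∀ s : Finset ℤ, ‖∑ j ∈ s, a j • φ j‖ ≤ √K * ‖a‖ := fun s => by
        have hK0 : 0 ≤ K := by
          have := hK {0} 1
          simp at this
          exact (by positivity : (0 : ℝ) ≤ _).trans this
        refine le_of_sq_le_sq ?_ (by positivity)
        rw [mul_pow, Real.sq_sqrt hK0, norm_sq_eq_tsum]
        exact (hK s a).trans (mul_le_mul_of_nonneg_left
          ((summable_norm_sq a).sum_le_tsum s fun j _ => by positivity) hK0)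
      exact le_of_tendsto (summable_smul_of_bessel hK a).hasSum.norm (.of_forall h)

theorem hasSum_synthesis
    (hK : ∀ (s : Finset ℤ) (c : ℤ → ℂ), ‖∑ j ∈ s, c j • φ j‖ ^ 2 ≤ K * ∑ j ∈ s, ‖c j‖ ^ 2)
    (a : EllTwo) : HasSum (fun j => a j • φ j) (synthesis φ K hK a) :=
  (summable_smul_of_bessel hK a).hasSum

theorem norm_synthesis_le
    (hK : ∀ (s : Finset ℤ) (c : ℤ → ℂ), ‖∑ j ∈ s, c j • φ j‖ ^ 2 ≤ K * ∑ j ∈ s, ‖c j‖ ^ 2)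
    (a : EllTwo) : ‖synthesis φ K hK a‖ ≤ √K * ‖a‖ :=
  ((synthesis φ K hK).le_opNorm a).trans
    (mul_le_mul_of_nonneg_right (LinearMap.mkContinuous_norm_le _ (Real.sqrt_nonneg K) _)
      (norm_nonneg a))

/-- The coefficients of the adjoint of a synthesis operator. -/
theorem adjoint_apply_of_hasSum {T : EllTwo →L[ℂ] H}
    (hT : ∀ a : EllTwo, HasSum (fun j => a j • φ j) (T a)) (h : H) (k : ℤ) :
    (ContinuousLinearMap.adjoint T h : EllTwo) k = inner ℂ (φ k) h := by
  have h1 : T (lp.single 2 k 1) = φ k := by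
    refine (hT _).unique ?_
    convert! hasSum_ite_eq k (φ k) using 2 with j
    by_cases hj : j = k
    · subst hj; simp
    · simp [hj, lp.single_apply]
  rw [← h1, ← ContinuousLinearMap.adjoint_inner_right, lp.inner_single_left]
  simp

end Synthesis

/-! ### Exponentials in weighted `L²` spaces -/

theorem eLpNorm_two_sq {f : ℝ → ℂ} {μ : Measure ℝ} :
    eLpNorm f 2 μ ^ 2 = ∫⁻ u, ‖f u‖ₑ ^ 2 ∂μ := by
  rw [eLpNorm_eq_lintegral_rpow_enorm_toReal (by simp) (by simp), ← ENNReal.rpow_natCast,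
    ← ENNReal.rpow_mul]
  simp

theorem norm_toLp_sq_le_iff {f : ℝ → ℂ} {μ : Measure ℝ} (hf : MemLp f 2 μ) {c : ℝ} (hc : 0 ≤ c) :
    ‖hf.toLp f‖ ^ 2 ≤ c ↔ ∫⁻ u, ‖f u‖ₑ ^ 2 ∂μ ≤ ENNReal.ofReal c := by
  rw [← eLpNorm_two_sq, ← Lp.enorm_toLp hf, ← ofReal_norm, ← ENNReal.ofReal_pow (norm_nonneg _),
    ENNReal.ofReal_le_ofReal_iff hc]

theorem memLp_exp_of_isFiniteMeasure (μ : Measure ℝ) [IsFiniteMeasure μ] (s : ℝ) :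
    MemLp (fun t : ℝ => Complex.exp (-(Complex.I * s * t))) 2 μ := by
  refine MemLp.of_bound (C := 1) ?_ (Filter.Eventually.of_forall fun t => ?_)
  · exact (by fun_prop : Continuous
      (fun t : ℝ => Complex.exp (-(Complex.I * s * t)))).aestronglyMeasurable
  · rw [Complex.norm_exp]
    simp

/-- The exponential `t ↦ e^{-i s t}` as an element of `L₂(μ)`. -/
def expLp (μ : Measure ℝ) [IsFiniteMeasure μ] (s : ℝ) : Lp ℂ 2 μ :=
  (memLp_exp_of_isFiniteMeasure μ s).toLp _

theorem expLp_coeFn (μ : Measure ℝ) [IsFiniteMeasure μ] (s : ℝ) :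
    expLp μ s =ᵐ[μ] fun t : ℝ => Complex.exp (-(Complex.I * s * t)) :=
  MemLp.coeFn_toLp _

theorem memLp_sum_exp (μ : Measure ℝ) [IsFiniteMeasure μ] (x : ℤ → ℝ) (s : Finset ℤ) (c : ℤ → ℂ) :
    MemLp (fun u : ℝ => ∑ j ∈ s, c j * Complex.exp (-(Complex.I * x j * u))) 2 μ :=
  memLp_finsetSum s fun j _ => (memLp_exp_of_isFiniteMeasure μ (x j)).const_mul (c j)

theorem sum_smul_expLp (μ : Measure ℝ) [IsFiniteMeasure μ] (x : ℤ → ℝ) (s : Finset ℤ)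
    (c : ℤ → ℂ) : ∑ j ∈ s, c j • expLp μ (x j) = (memLp_sum_exp μ x s c).toLp _ := by
  classical
  induction s using Finset.induction_on with
  | empty => simp
  | insert j s hj ih =>
    rw [Finset.sum_insert hj, ih, expLp, ← MemLp.toLp_const_smul, ← MemLp.toLp_add]
    refine MemLp.toLp_congr _ _ (.of_forall fun u => ?_)
    simp [Finset.sum_insert hj]

theorem IsRieszBasis.norm_sum_sq_le {H : Type*} [NormedAddCommGroup H] [InnerProductSpace ℂ H]
    {φ : ℤ → H} (hφ : IsRieszBasis φ) : ∃ B : ℝ, 0 < B ∧ ∀ (s : Finset ℤ) (c : ℤ → ℂ),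
      ‖∑ j ∈ s, c j • φ j‖ ^ 2 ≤ B * ∑ j ∈ s, ‖c j‖ ^ 2 := by
  classical
  obtain ⟨B, hB, h⟩ := hφ.bounds
  refine ⟨B ^ 2, by positivity, fun s c => ?_⟩
  obtain ⟨-, -, h2⟩ := h (∑ j ∈ s, lp.single 2 j (c j))
  have hk : ∀ k, (∑ j ∈ s, lp.single 2 j (c j) : EllTwo) k = if k ∈ s then c k else 0 := fun k => by
    rw [lp.coeFn_sum, Finset.sum_apply]
    simp only [lp.single_apply]
    exact Finset.sum_pi_single k c s
  have e : ∑' k, (∑ j ∈ s, lp.single 2 j (c j) : EllTwo) k • φ k = ∑ j ∈ s, c j • φ j := by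
    rw [tsum_eq_sum (s := s) fun k h => by rw [hk, if_neg h, zero_smul]]
    exact Finset.sum_congr rfl fun k h => by rw [hk, if_pos h]
  rw [e] at h2
  have h3 := lp.norm_sum_single (E := fun _ : ℤ => ℂ) (p := 2) (by simp) c s
  simp only [ENNReal.toReal_ofNat, Real.rpow_ofNat] at h3
  rw [← h3, ← mul_pow]
  gcongr

/-- Translating the frequency by `v` multiplies `c j` by a unimodular factor, so the Bessel bound is
the same on every translate of the band. -/
theorem lintegral_translate_le {x : ℤ → ℝ} {B : ℝ} (hB0 : 0 ≤ B)
    (hB : ∀ (s : Finset ℤ) (c : ℤ → ℂ),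
      ‖∑ j ∈ s, c j • expBand (x j)‖ ^ 2 ≤ B * ∑ j ∈ s, ‖c j‖ ^ 2)
    (s : Finset ℤ) (c : ℤ → ℂ) (v : ℝ) :
    ∫⁻ u in Set.Icc (-Real.pi) Real.pi,
      ‖∑ j ∈ s, c j * Complex.exp (-(Complex.I * x j * ((u + v : ℝ) : ℂ)))‖ₑ ^ 2
      ≤ ENNReal.ofReal (B * ∑ j ∈ s, ‖c j‖ ^ 2) := by
  have h := hB s fun j => c j * Complex.exp (-(Complex.I * x j * v))
  have e : ∀ j, ‖c j * Complex.exp (-(Complex.I * x j * v))‖ = ‖c j‖ := fun j => by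
    rw [norm_mul, Complex.norm_exp]
    simp
  simp only [e] at h
  have h0 : 0 ≤ B * ∑ j ∈ s, ‖c j‖ ^ 2 :=
    mul_nonneg hB0 (Finset.sum_nonneg fun j _ => by positivity)
  have h1 := sum_smul_expLp (volume.restrict (Set.Icc (-Real.pi) Real.pi)) x s
    fun j => c j * Complex.exp (-(Complex.I * x j * v))
  change ∑ j ∈ s, _ • expBand (x j) = _ at h1
  rw [h1, norm_toLp_sq_le_iff _ h0] at h
  refine le_of_eq_of_le (lintegral_congr fun u => ?_) h
  congr 2
  refine Finset.sum_congr rfl fun j _ => ?_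
  rw [mul_assoc (c j), ← Complex.exp_add]
  congr 2
  push_cast
  ring

/-- The measure `e^{-b u²} du`. -/
def gaussMeasure (b : ℝ) : Measure ℝ := volume.withDensity fun u => ENNReal.ofReal (gaussian b u)

theorem integrable_gaussian {b : ℝ} (hb : 0 < b) : Integrable (gaussian b) :=
  integrable_exp_neg_mul_sq hb

theorem continuous_gaussian (b : ℝ) : Continuous (gaussian b) := by
  unfold gaussian
  fun_prop

theorem gaussian_pos (b u : ℝ) : 0 < gaussian b u := Real.exp_pos _

theorem gaussian_le_one {b : ℝ} (hb : 0 ≤ b) (u : ℝ) : gaussian b u ≤ 1 := by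
  rw [gaussian, Real.exp_le_one_iff]
  nlinarith [mul_nonneg hb (sq_nonneg u)]

theorem isFiniteMeasure_gaussMeasure {b : ℝ} (hb : 0 < b) : IsFiniteMeasure (gaussMeasure b) :=
  isFiniteMeasure_withDensity_ofReal (integrable_gaussian hb).2

instance : IsFiniteMeasure (gaussMeasure 4⁻¹) := isFiniteMeasure_gaussMeasure (by norm_num)

/-- If the exponentials are a Bessel sequence on `[-π, π]` then they are one with respect to
a Gaussian weight on the line. -/
theorem exists_gaussMeasure_bessel {x : ℤ → ℝ} {B : ℝ} (hB0 : 0 ≤ B)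
    (hB : ∀ (s : Finset ℤ) (c : ℤ → ℂ),
      ‖∑ j ∈ s, c j • expBand (x j)‖ ^ 2 ≤ B * ∑ j ∈ s, ‖c j‖ ^ 2) :
    ∃ K : ℝ, 0 < K ∧ ∀ (s : Finset ℤ) (c : ℤ → ℂ),
      ‖∑ j ∈ s, c j • expLp (gaussMeasure 4⁻¹) (x j)‖ ^ 2 ≤ K * ∑ j ∈ s, ‖c j‖ ^ 2 := by
  set I : ℝ := ∫ v, gaussian 8⁻¹ v with hI
  have hI0 : 0 ≤ I := integral_nonneg fun v => (gaussian_pos _ v).le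
  -- `2π` is the length of the band over which `u` is averaged; `e^{-π²/4}` is the loss in comparing
  -- the weight of parameter `4⁻¹` with translates by `u` of the wider one of parameter `8⁻¹`.
  set δ : ℝ := Real.exp (-(Real.pi ^ 2 / 4)) * (2 * Real.pi) with hδ
  have hδ0 : 0 < δ := by positivity
  refine ⟨δ⁻¹ * (I * B) + 1, by positivity, fun s c => ?_⟩
  set S : ℝ := ∑ j ∈ s, ‖c j‖ ^ 2 with hS
  have hS0 : 0 ≤ S := Finset.sum_nonneg fun j _ => by positivity
  refine le_trans ?_ (mul_le_mul_of_nonneg_right (le_add_of_nonneg_right zero_le_one) hS0)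
  rw [sum_smul_expLp, norm_toLp_sq_le_iff _ (by positivity)]
  set p : ℝ → ℂ := fun u => ∑ j ∈ s, c j * Complex.exp (-(Complex.I * x j * u)) with hp
  have hpc : Continuous p := by fun_prop
  have hg8 := continuous_gaussian 8⁻¹
  have hg4 := continuous_gaussian 4⁻¹
  set P : Set ℝ := Set.Icc (-Real.pi) Real.pi with hP
  have key : ENNReal.ofReal δ * ∫⁻ u, ‖p u‖ₑ ^ 2 ∂(gaussMeasure 4⁻¹)
      ≤ ENNReal.ofReal (I * (B * S)) := by
    calc ENNReal.ofReal δ * ∫⁻ u, ‖p u‖ₑ ^ 2 ∂(gaussMeasure 4⁻¹)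
        = ∫⁻ u in P, ∫⁻ v, ENNReal.ofReal (Real.exp (-(Real.pi ^ 2 / 4))) *
            (ENNReal.ofReal (gaussian 4⁻¹ v) * ‖p v‖ₑ ^ 2) := by
          rw [gaussMeasure, lintegral_withDensity_eq_lintegral_mul _ (by fun_prop) (by fun_prop),
            lintegral_const, Measure.restrict_apply_univ, Real.volume_Icc,
            lintegral_const_mul _ (by fun_prop), mul_right_comm, hδ,
            ENNReal.ofReal_mul (by positivity), sub_neg_eq_add, ← two_mul]
          rfl
      _ ≤ ∫⁻ u in P, ∫⁻ v, ENNReal.ofReal (gaussian 8⁻¹ (v - u)) * ‖p v‖ₑ ^ 2 := by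
          refine setLIntegral_mono' measurableSet_Icc fun u hu => lintegral_mono fun v => ?_
          simp only
          rw [← mul_assoc, ← ENNReal.ofReal_mul (by positivity)]
          gcongr
          rw [gaussian, gaussian, ← Real.exp_add, Real.exp_le_exp]
          have : u ^ 2 ≤ Real.pi ^ 2 := sq_le_sq' hu.1 hu.2
          -- `(v - u)²/8 ≤ (v² + u²)/4 ≤ v²/4 + π²/4`.
          nlinarith [sq_nonneg (u + v)]
      _ = ∫⁻ u in P, ∫⁻ v, ENNReal.ofReal (gaussian 8⁻¹ v) * ‖p (u + v)‖ₑ ^ 2 := by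
          refine lintegral_congr fun u => ?_
          rw [← lintegral_add_left_eq_self _ u]
          simp
      _ = ∫⁻ v, ∫⁻ u in P, ENNReal.ofReal (gaussian 8⁻¹ v) * ‖p (u + v)‖ₑ ^ 2 := by
          refine lintegral_lintegral_swap (Measurable.aemeasurable ?_)
          have : Continuous (fun z : ℝ × ℝ => gaussian 8⁻¹ z.2) := hg8.comp continuous_snd
          fun_prop
      _ ≤ ∫⁻ v, ENNReal.ofReal (gaussian 8⁻¹ v) * ENNReal.ofReal (B * S) := by
          refine lintegral_mono fun v => ?_
          simp only
          rw [lintegral_const_mul _ (by fun_prop)]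
          gcongr
          exact lintegral_translate_le hB0 hB s c v
      _ = ENNReal.ofReal (I * (B * S)) := by
          rw [lintegral_mul_const _ (by fun_prop), ENNReal.ofReal_mul hI0, hI,
            ofReal_integral_eq_lintegral_ofReal (integrable_gaussian (by norm_num))
              (.of_forall fun v => (gaussian_pos _ v).le)]
  have hδ' : ENNReal.ofReal δ ≠ 0 := by simpa using hδ0
  rw [mul_assoc, mul_assoc, ENNReal.ofReal_mul (by positivity), ENNReal.ofReal_inv_of_pos hδ0,
    ← ENNReal.div_eq_inv_mul, ENNReal.le_div_iff_mul_le (.inl hδ') (.inl ENNReal.ofReal_ne_top),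
    mul_comm]
  exact key


/-! ### Comparison of weights and Gram matrices -/

section Restrict

variable {μ ν : Measure ℝ} {c : ℝ≥0∞}

/-- The canonical map `L₂(ν) → L₂(μ)` when `μ` is bounded by a finite multiple of `ν`. -/
def restrictLp (hc : c ≠ ∞) (h : μ ≤ c • ν) : Lp ℂ 2 ν →L[ℂ] Lp ℂ 2 μ where
  toFun := Lp.LpToLpOfMeasureLeSMul hc h
  map_add' := map_add _
  map_smul' a f := by
    have ha : μ ≪ ν := Measure.absolutelyContinuous_of_le_smul h
    refine Lp.ext ?_
    filter_upwards [Lp.coeFn_LpToLpOfMeasureLeSMul hc h (a • f),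
      Lp.coeFn_LpToLpOfMeasureLeSMul hc h f, ha.ae_eq (Lp.coeFn_smul a f),
      Lp.coeFn_smul a (Lp.LpToLpOfMeasureLeSMul hc h f)] with u h1 h2 h3 h4
    rw [RingHom.id_apply, h1, h3, h4, Pi.smul_apply, Pi.smul_apply, h2]
  cont := (Lp.LpToLpOfMeasureLeSMul hc h).continuous

theorem coeFn_restrictLp (hc : c ≠ ∞) (h : μ ≤ c • ν) (f : Lp ℂ 2 ν) :
    restrictLp hc h f =ᵐ[μ] f :=
  Lp.coeFn_LpToLpOfMeasureLeSMul hc h f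

theorem restrictLp_expLp [IsFiniteMeasure μ] [IsFiniteMeasure ν] (hc : c ≠ ∞) (h : μ ≤ c • ν)
    (s : ℝ) : restrictLp hc h (expLp ν s) = expLp μ s := by
  have ha : μ ≪ ν := Measure.absolutelyContinuous_of_le_smul h
  exact Lp.ext ((coeFn_restrictLp hc h _).trans
    ((ha.ae_eq (expLp_coeFn ν s)).trans (expLp_coeFn μ s).symm))

theorem enorm_Lp_sq (f : Lp ℂ 2 μ) : ‖f‖ₑ ^ 2 = ∫⁻ u, ‖f u‖ₑ ^ 2 ∂μ := by
  rw [Lp.enorm_def, eLpNorm_two_sq]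

theorem norm_sq_le_of_ae_eq {c : ℝ} (hc : 0 ≤ c) (h : μ ≤ ENNReal.ofReal c • ν) {f : Lp ℂ 2 μ}
    {g : Lp ℂ 2 ν} (hfg : f =ᵐ[μ] g) : ‖f‖ ^ 2 ≤ c * ‖g‖ ^ 2 := by
  have : ‖f‖ₑ ^ 2 ≤ ENNReal.ofReal c * ‖g‖ₑ ^ 2 := by
    rw [enorm_Lp_sq, enorm_Lp_sq, lintegral_congr_ae (g := fun u => ‖g u‖ₑ ^ 2)
      (by filter_upwards [hfg] with u hu; rw [hu])]
    refine (lintegral_mono' h le_rfl).trans ?_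
    rw [lintegral_smul_measure, smul_eq_mul]
  rwa [← ofReal_norm, ← ofReal_norm, ← ENNReal.ofReal_pow (norm_nonneg _),
    ← ENNReal.ofReal_pow (norm_nonneg _), ← ENNReal.ofReal_mul hc,
    ENNReal.ofReal_le_ofReal_iff (by positivity)] at this

end Restrict

theorem gaussMeasure_zero : gaussMeasure 0 = volume := by
  simp [gaussMeasure, gaussian]

theorem restrict_gaussMeasure_le {b b' c : ℝ} (hc : 0 ≤ c) {A : Set ℝ} (hA : MeasurableSet A)
    (h : ∀ u ∈ A, gaussian b u ≤ c * gaussian b' u) :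
    (gaussMeasure b).restrict A ≤ ENNReal.ofReal c • gaussMeasure b' := by
  have hb' := continuous_gaussian b'
  rw [gaussMeasure, gaussMeasure, restrict_withDensity hA, ← withDensity_smul _ (by fun_prop)]
  calc (volume.restrict A).withDensity (fun u => ENNReal.ofReal (gaussian b u))
      ≤ (volume.restrict A).withDensity
          (ENNReal.ofReal c • fun u => ENNReal.ofReal (gaussian b' u)) := by
        refine withDensity_mono ((ae_restrict_iff' hA).2 (.of_forall fun u hu => ?_))
        rw [Pi.smul_apply, smul_eq_mul, ← ENNReal.ofReal_mul hc]
        exact ENNReal.ofReal_le_ofReal (h u hu)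
    _ = (volume.withDensity (ENNReal.ofReal c • fun u => ENNReal.ofReal (gaussian b' u))).restrict A :=
        (restrict_withDensity hA _).symm
    _ ≤ _ := Measure.restrict_le_self

theorem setIntegral_gaussMeasure (b : ℝ) (g : ℝ → ℂ) {A : Set ℝ} (hA : MeasurableSet A) :
    ∫ u in A, g u ∂(gaussMeasure b) = ∫ u in A, (gaussian b u : ℂ) * g u := by
  have hb := continuous_gaussian b
  rw [gaussMeasure, setIntegral_withDensity_eq_setIntegral_toReal_smul (by fun_prop) (by simp) _ hA]
  refine integral_congr_ae (.of_forall fun u => ?_)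
  simp only
  rw [ENNReal.toReal_ofReal (gaussian_pos b u).le, Complex.real_smul]

theorem integral_gaussMeasure (b : ℝ) (g : ℝ → ℂ) :
    ∫ u, g u ∂(gaussMeasure b) = ∫ u, (gaussian b u : ℂ) * g u := by
  simpa using setIntegral_gaussMeasure b g MeasurableSet.univ

theorem integrable_gaussMeasure_iff (b : ℝ) (g : ℝ → ℂ) :
    Integrable g (gaussMeasure b) ↔ Integrable fun u => (gaussian b u : ℂ) * g u := by
  have hb := continuous_gaussian b
  rw [gaussMeasure, integrable_withDensity_iff_integrable_smul' (by fun_prop) (by simp)]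
  refine integrable_congr (.of_forall fun u => ?_)
  simp only
  rw [ENNReal.toReal_ofReal (gaussian_pos b u).le, Complex.real_smul]

theorem inner_expLp (μ : Measure ℝ) [IsFiniteMeasure μ] (t : ℝ) {F : Lp ℂ 2 μ} {g : ℝ → ℂ}
    (hF : F =ᵐ[μ] g) :
    inner ℂ (expLp μ t) F = ∫ u, g u * Complex.exp (Complex.I * u * t) ∂μ := by
  rw [L2.inner_def]
  refine integral_congr_ae ?_
  filter_upwards [expLp_coeFn μ t, hF] with u hu hFu
  rw [hu, hFu, RCLike.inner_apply, ← Complex.exp_conj]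
  simp only [map_neg, map_mul, Complex.conj_I, Complex.conj_ofReal]
  congr 2
  ring

theorem inner_expLp_gaussMeasure {b : ℝ} [IsFiniteMeasure (gaussMeasure b)] (t : ℝ)
    {F : Lp ℂ 2 (gaussMeasure b)} {g : ℝ → ℂ} (hF : F =ᵐ[gaussMeasure b] g) :
    inner ℂ (expLp (gaussMeasure b) t) F = invFourier (fun u => (gaussian b u : ℂ) * g u) t := by
  rw [inner_expLp _ t hF, integral_gaussMeasure, invFourier]
  refine integral_congr_ae (.of_forall fun u => ?_)
  simp only
  ring

/-- The interpolation matrix is thus, up to a positive scalar, the Gram matrix of the exponentials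
in the weighted space. -/
theorem inner_expLp_expLp {lam : ℝ} (hl : 0 < lam) [IsFiniteMeasure (gaussMeasure (4 * lam)⁻¹)]
    (t s : ℝ) :
    inner ℂ (expLp (gaussMeasure (4 * lam)⁻¹) t) (expLp (gaussMeasure (4 * lam)⁻¹) s)
      = (√(4 * Real.pi * lam) * gaussian lam (t - s) : ℝ) := by
  rw [inner_expLp_gaussMeasure t (expLp_coeFn _ s), ← invFourier_gaussian hl, invFourier, invFourier]
  refine integral_congr_ae (.of_forall fun u => ?_)
  simp only
  rw [mul_assoc, ← Complex.exp_add]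
  congr 2
  push_cast
  ring

/-! ### Hilbert space estimates -/

section Abstract

open ContinuousLinearMap

variable {E H H' : Type*}
  [NormedAddCommGroup E] [InnerProductSpace ℂ E] [CompleteSpace E]
  [NormedAddCommGroup H] [InnerProductSpace ℂ H] [CompleteSpace H]
  [NormedAddCommGroup H'] [InnerProductSpace ℂ H'] [CompleteSpace H']

/-- `⟨T*T a, a⟩ = ‖T a‖²`, so the operator is coercive and Lax–Milgram applies. -/
theorem bijective_adjoint_comp_self {T : E →L[ℂ] H} {δ : ℝ} (hδ : 0 < δ)
    (h : ∀ a, δ * ‖a‖ ^ 2 ≤ ‖T a‖ ^ 2) : Function.Bijective (adjoint T ∘L T) := by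
  rw [← isUnit_iff_bijective]
  refine isUnit_of_forall_le_norm_inner_map _ (c := ⟨δ, hδ.le⟩) hδ fun a => ?_
  have := h a
  rw [ContinuousLinearMap.comp_apply, adjoint_inner_left, inner_self_eq_norm_sq_to_K]
  simp only [norm_pow, RCLike.norm_ofReal, abs_norm]
  rw [mul_comm]
  exact this

/-- Write `h = T a`; then `‖h‖² = ⟨a, T*h⟩ ≤ ‖a‖ ‖T*h‖` and `‖a‖ ≤ B‖h‖`. Surjectivity is essential:
`T*` vanishes on the orthogonal complement of the range. -/
theorem norm_le_norm_adjoint {T : E →L[ℂ] H} {B : ℝ} (hB : 0 < B) (hT : ∀ a, B⁻¹ * ‖a‖ ≤ ‖T a‖)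
    (hs : Function.Surjective T) (h : H) : ‖h‖ ≤ B * ‖adjoint T h‖ := by
  obtain ⟨a, rfl⟩ := hs h
  have h1 : ‖T a‖ ^ 2 ≤ ‖a‖ * ‖adjoint T (T a)‖ := by
    refine le_trans (le_of_eq ?_) (norm_inner_le_norm (𝕜 := ℂ) a (adjoint T (T a)))
    rw [adjoint_inner_right, inner_self_eq_norm_sq_to_K]
    simp
  have h2 : ‖a‖ ≤ B * ‖T a‖ := by
    rw [← inv_mul_le_iff₀ hB]; exact hT a
  rcases (norm_nonneg (T a)).eq_or_lt with h0 | h0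
  · rw [← h0]; positivity
  · nlinarith [norm_nonneg (adjoint T (T a))]

/-- The energy estimate behind the uniform boundedness: `T` is the synthesis operator on the band,
`S` the one for the full weight, and `R` the one for the weight outside of the band. -/
theorem energy_estimate {H'' : Type*} [NormedAddCommGroup H''] [InnerProductSpace ℂ H'']
    [CompleteSpace H''] {T : E →L[ℂ] H} {S : E →L[ℂ] H'} {R : E →L[ℂ] H''} {B m K : ℝ}
    (hB : 0 < B) (hm : 0 < m) (hK : 0 ≤ K) (hT : ∀ a, B⁻¹ * ‖a‖ ≤ ‖T a‖)
    (hT' : ∀ a, ‖T a‖ ≤ B * ‖a‖) (hs : Function.Surjective T)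
    (hS : ∀ a, m * ‖T a‖ ^ 2 ≤ ‖S a‖ ^ 2) (hR : ∀ a, ‖R a‖ ^ 2 ≤ m * K * ‖a‖ ^ 2)
    {b : E} {ψ q : H} (hq : adjoint S (S b) = adjoint T q)
    (hψ : adjoint S (S b) = adjoint T ψ + adjoint R (R b)) :
    ‖ψ‖ ^ 2 + m * ‖R b‖ ^ 2 ≤ ((1 + K * B ^ 4) ^ 2 + K * B ^ 6) * ‖q‖ ^ 2 := by
  have hb0 := norm_nonneg b
  have hq0 := norm_nonneg q
  have hTadj : ‖adjoint T q‖ ≤ B * ‖q‖ := by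
    refine (le_opNorm _ _).trans (mul_le_mul_of_nonneg_right ?_ hq0)
    rw [LinearIsometryEquiv.norm_map]
    exact opNorm_le_bound _ hB.le hT'
  have hRadj : ‖adjoint R (R b)‖ ≤ m * K * ‖b‖ := by
    have h1 : ‖R‖ ≤ √(m * K) := opNorm_le_bound _ (Real.sqrt_nonneg _) fun a => by
      refine le_of_sq_le_sq ?_ (by positivity)
      rw [mul_pow, Real.sq_sqrt (by positivity)]
      exact hR a
    calc ‖adjoint R (R b)‖ ≤ ‖adjoint R‖ * ‖R b‖ := le_opNorm _ _
      _ ≤ √(m * K) * (√(m * K) * ‖b‖) := by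
        rw [LinearIsometryEquiv.norm_map]
        gcongr
        exact (le_opNorm _ _).trans (mul_le_mul_of_nonneg_right h1 hb0)
      _ = m * K * ‖b‖ := by rw [← mul_assoc, Real.mul_self_sqrt (by positivity)]
  have hSb : ‖S b‖ ^ 2 ≤ ‖b‖ * (B * ‖q‖) := by
    have h1 : ‖S b‖ ^ 2 ≤ ‖b‖ * ‖adjoint S (S b)‖ := by
      refine le_trans (le_of_eq ?_) (norm_inner_le_norm (𝕜 := ℂ) b (adjoint S (S b)))
      rw [adjoint_inner_right, inner_self_eq_norm_sq_to_K]
      simp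
    rw [hq] at h1
    exact h1.trans (mul_le_mul_of_nonneg_left hTadj hb0)
  -- `m‖b‖² ≤ B² m‖T b‖² ≤ B²‖S b‖² ≤ B³‖b‖‖q‖`. The coefficients may grow like `m⁻¹`, which the
  -- factor `m` in the bound for `R` compensates.
  have hmb : m * ‖b‖ ≤ B ^ 3 * ‖q‖ := by
    rcases hb0.eq_or_lt with h0 | h0
    · rw [← h0, mul_zero]; positivity
    · have h1 : ‖b‖ ≤ B * ‖T b‖ := by
        rw [← inv_mul_le_iff₀ hB]; exact hT b
      have h2 : ‖b‖ ^ 2 ≤ B ^ 2 * ‖T b‖ ^ 2 := by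
        rw [← mul_pow]; gcongr
      have h3 : m * ‖b‖ * ‖b‖ ≤ B ^ 3 * ‖q‖ * ‖b‖ := by
        calc m * ‖b‖ * ‖b‖ = m * ‖b‖ ^ 2 := by ring
          _ ≤ m * (B ^ 2 * ‖T b‖ ^ 2) := by gcongr
          _ = B ^ 2 * (m * ‖T b‖ ^ 2) := by ring
          _ ≤ B ^ 2 * (‖b‖ * (B * ‖q‖)) := by
            exact mul_le_mul_of_nonneg_left ((hS b).trans hSb) (by positivity)
          _ = B ^ 3 * ‖q‖ * ‖b‖ := by ring
      exact le_of_mul_le_mul_right h3 h0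
  -- `T*` maps `q - ψ` to the off-band contribution `R*R b`, whose norm is at most `mK‖b‖`.
  have hdiff : ‖q - ψ‖ ≤ K * B ^ 4 * ‖q‖ := by
    have h1 := norm_le_norm_adjoint hB hT hs (q - ψ)
    have h2 : adjoint T (q - ψ) = adjoint R (R b) := by
      rw [map_sub, ← hq, hψ, add_sub_cancel_left]
    rw [h2] at h1
    calc ‖q - ψ‖ ≤ B * (m * K * ‖b‖) := h1.trans (by gcongr)
      _ = B * K * (m * ‖b‖) := by ring
      _ ≤ B * K * (B ^ 3 * ‖q‖) := by gcongr
      _ = K * B ^ 4 * ‖q‖ := by ring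
  have hψn : ‖ψ‖ ≤ (1 + K * B ^ 4) * ‖q‖ := by
    have := norm_sub_le q (q - ψ)
    rw [sub_sub_cancel] at this
    linarith
  have hRn : m * ‖R b‖ ^ 2 ≤ K * B ^ 6 * ‖q‖ ^ 2 := by
    calc m * ‖R b‖ ^ 2 ≤ m * (m * K * ‖b‖ ^ 2) := by gcongr; exact hR b
      _ = K * (m * ‖b‖) ^ 2 := by ring
      _ ≤ K * (B ^ 3 * ‖q‖) ^ 2 := by gcongr
      _ = K * B ^ 6 * ‖q‖ ^ 2 := by ring
  have hψn2 : ‖ψ‖ ^ 2 ≤ ((1 + K * B ^ 4) * ‖q‖) ^ 2 := by gcongr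
  linarith

end Abstract


/-! ### Gaussian weights inside and outside the band -/

/-- The frequency band `[-π, π]`. -/
abbrev band : Set ℝ := Set.Icc (-Real.pi) Real.pi

theorem gaussian_le_of_mem_band {b : ℝ} (hb : 0 ≤ b) {u : ℝ} (hu : u ∈ band) :
    gaussian b Real.pi ≤ gaussian b u := by
  have : u ^ 2 ≤ Real.pi ^ 2 := sq_le_sq' hu.1 hu.2
  rw [gaussian, gaussian, Real.exp_le_exp]
  nlinarith [mul_le_mul_of_nonneg_left this hb]

theorem sq_pi_le_of_notMem_band {u : ℝ} (hu : u ∉ band) : Real.pi ^ 2 ≤ u ^ 2 := by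
  rw [sq_le_sq, abs_of_pos Real.pi_pos]
  by_contra! h
  exact hu ⟨(abs_lt.1 h).1.le, (abs_lt.1 h).2.le⟩

theorem gaussian_le_of_notMem_band {b : ℝ} (hb : 0 ≤ b) {u : ℝ} (hu : u ∉ band) :
    gaussian b u ≤ gaussian b Real.pi := by
  rw [gaussian, gaussian, Real.exp_le_exp]
  nlinarith [mul_le_mul_of_nonneg_left (sq_pi_le_of_notMem_band hu) hb]

theorem restrict_band_le_gaussMeasure {b : ℝ} (hb : 0 ≤ b) :
    volume.restrict band ≤ ENNReal.ofReal (gaussian b Real.pi)⁻¹ • gaussMeasure b := by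
  rw [← gaussMeasure_zero]
  refine restrict_gaussMeasure_le (inv_nonneg.2 (gaussian_pos _ _).le) measurableSet_Icc
    fun u hu => ?_
  rw [inv_mul_eq_div, le_div_iff₀ (gaussian_pos _ _)]
  simpa [gaussian] using gaussian_le_of_mem_band hb hu

theorem gaussMeasure_le {b b' : ℝ} (h : b' ≤ b) :
    gaussMeasure b ≤ ENNReal.ofReal 1 • gaussMeasure b' := by
  have := restrict_gaussMeasure_le (b := b) (b' := b') zero_le_one MeasurableSet.univ fun u _ => by
    rw [one_mul, gaussian, gaussian, Real.exp_le_exp]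
    nlinarith [mul_le_mul_of_nonneg_right h (sq_nonneg u)]
  rwa [Measure.restrict_univ] at this

/-- The ratio `e^{-(b - b')u²}` of the weights decreases in `|u|`, so off the band it is largest at
the edge `±π`. The factor `gaussian b π` is the `m` of the energy estimate. -/
theorem gaussMeasure_restrict_compl_band_le {b b' : ℝ} (h : b' ≤ b) :
    (gaussMeasure b).restrict bandᶜ
      ≤ ENNReal.ofReal (gaussian b Real.pi * (gaussian b' Real.pi)⁻¹) • gaussMeasure b' := by
  refine restrict_gaussMeasure_le (mul_nonneg (gaussian_pos _ _).le
    (inv_nonneg.2 (gaussian_pos _ _).le)) measurableSet_Icc.compl fun u hu => ?_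
  simp only [gaussian]
  rw [← Real.exp_neg, ← Real.exp_add, ← Real.exp_add, Real.exp_le_exp]
  nlinarith [mul_le_mul_of_nonneg_left (sq_pi_le_of_notMem_band hu) (sub_nonneg.2 h)]

theorem memLp_gaussian_mul {b : ℝ} (hb : 0 ≤ b) {μ : Measure ℝ} {F : ℝ → ℂ} (hF : MemLp F 2 μ) :
    MemLp (fun u => (gaussian b u : ℂ) * F u) 2 μ := by
  have hg := continuous_gaussian b
  refine hF.of_le ((by fun_prop : Continuous fun u => (gaussian b u : ℂ)).aestronglyMeasurable.mul
    hF.1) (.of_forall fun u => ?_)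
  rw [norm_mul, Complex.norm_real, Real.norm_of_nonneg (gaussian_pos b u).le]
  exact mul_le_of_le_one_left (norm_nonneg _) (gaussian_le_one hb u)

/-- The energy of a weighted function splits into the part in the band and the part outside. -/
theorem lintegral_gaussian_mul_le {b : ℝ} (hb : 0 ≤ b) {F : ℝ → ℂ} (hF : StronglyMeasurable F) :
    ∫⁻ u, ‖(gaussian b u : ℂ) * F u‖ₑ ^ 2 ≤
      (∫⁻ u in band, ‖(gaussian b u : ℂ) * F u‖ₑ ^ 2) + ENNReal.ofReal (gaussian b Real.pi) *
        ∫⁻ u in bandᶜ, ‖F u‖ₑ ^ 2 ∂(gaussMeasure b) := by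
  have hg := continuous_gaussian b
  have hFm := hF.measurable
  rw [← lintegral_add_compl _ (measurableSet_Icc : MeasurableSet band)]
  gcongr
  rw [gaussMeasure, setLIntegral_withDensity_eq_setLIntegral_mul _ (by fun_prop) (by fun_prop)
    measurableSet_Icc.compl, ← lintegral_const_mul _ (by fun_prop)]
  refine setLIntegral_mono' measurableSet_Icc.compl fun u hu => ?_
  have e : ‖(gaussian b u : ℂ)‖ₑ = ENNReal.ofReal (gaussian b u) := by
    rw [← ofReal_norm, Complex.norm_real, Real.norm_of_nonneg (gaussian_pos b u).le]
  rw [enorm_mul, mul_pow, e, Pi.mul_apply, ← mul_assoc, sq (ENNReal.ofReal _)]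
  gcongr
  exact gaussian_le_of_notMem_band hb hu

/-! ### The interpolation system on the frequency side -/

theorem exists_interpolation {x : ℤ → ℝ} (hx : IsRieszBasisSequence x) :
    ∃ D : ℝ, 0 ≤ D ∧ ∀ lam : ℝ, 0 < lam → lam ≤ 1 → ∀ q : ℝ → ℂ, MemLp q 2 volume →
      (∀ u ∉ band, q u = 0) →
      (∃! b : EllTwo, ∀ k, HasSum
        (fun j => b j * (√(4 * Real.pi * lam) * gaussian lam (x k - x j) : ℝ))
        (invFourier q (x k))) ∧
      ∀ b : EllTwo, (∀ k, HasSum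
        (fun j => b j * (√(4 * Real.pi * lam) * gaussian lam (x k - x j) : ℝ))
        (invFourier q (x k))) →
        ∃ G : ℝ → ℂ, Integrable G ∧ MemLp G 2 volume ∧
          eLpNorm G 2 volume ^ 2 ≤ ENNReal.ofReal D * eLpNorm q 2 volume ^ 2 ∧
          ∀ t, HasSum (fun j => b j * (√(4 * Real.pi * lam) * gaussian lam (t - x j) : ℝ))
            (invFourier G t) := by
  obtain ⟨B₁, hB₁, hbes⟩ := hx.isRieszBasis.norm_sum_sq_le
  obtain ⟨K, hK, hγ⟩ := exists_gaussMeasure_bessel hB₁.le hbes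
  obtain ⟨B, hB, hbounds⟩ := hx.isRieszBasis.bounds
  set Tγ := synthesis _ K hγ with hTγ
  have hTγs : ∀ a, HasSum (fun j => a j • expLp (gaussMeasure 4⁻¹) (x j)) (Tγ a) :=
    hasSum_synthesis hγ
  have hTγb : ∀ a, ‖Tγ a‖ ^ 2 ≤ K * ‖a‖ ^ 2 := fun a => by
    have := pow_le_pow_left₀ (norm_nonneg _) (norm_synthesis_le hγ a) 2
    rwa [mul_pow, Real.sq_sqrt hK.le] at this
  have hrestr : ∀ (μ : Measure ℝ) [IsFiniteMeasure μ] (c : ℝ)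
      (h : μ ≤ ENNReal.ofReal c • gaussMeasure 4⁻¹) (a : EllTwo),
      HasSum (fun j => a j • expLp μ (x j))
        ((restrictLp ENNReal.ofReal_ne_top h ∘L Tγ) a) := fun μ _ c h a => by
    have := (hTγs a).mapL (restrictLp ENNReal.ofReal_ne_top h)
    simp only [map_smul, restrictLp_expLp] at this
    exact this
  set m₁ := gaussian 4⁻¹ Real.pi with hm₁
  have hm₁0 : 0 < m₁ := gaussian_pos _ _
  have hband := restrict_band_le_gaussMeasure (b := 4⁻¹) (by norm_num)
  set T := restrictLp ENNReal.ofReal_ne_top hband ∘L Tγ with hT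
  have hTs : ∀ a : EllTwo, HasSum (fun j => a j • expBand (x j)) (T a) :=
    hrestr _ _ hband
  have hTlow : ∀ a, B⁻¹ * ‖a‖ ≤ ‖T a‖ := fun a => by
    rw [← (hTs a).tsum_eq]; exact (hbounds a).2.1
  have hTup : ∀ a, ‖T a‖ ≤ B * ‖a‖ := fun a => by
    rw [← (hTs a).tsum_eq]; exact (hbounds a).2.2
  have hTsurj : Function.Surjective T := fun h => by
    obtain ⟨a, ha, -⟩ := hx.isRieszBasis.existsUnique_expansion h
    exact ⟨a, (hTs a).unique ha⟩
  -- The constant of `energy_estimate` with `K * m₁⁻¹` for `K`; `m₁` belongs to the fixed weight of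
  -- parameter `4⁻¹`, so nothing here depends on `lam`.
  refine ⟨(1 + K * m₁⁻¹ * B ^ 4) ^ 2 + K * m₁⁻¹ * B ^ 6, by positivity,
    fun lam hl hl1 q hq hq0 => ?_⟩
  set β := (4 * lam)⁻¹ with hβ
  have hβ0 : 0 < β := by positivity
  -- The condition `lam ≤ 1` makes every weight dominated by the one of parameter `4⁻¹`, so a single
  -- synthesis operator `Tγ` induces `T`, `S` and `R`.
  have hβ4 : 4⁻¹ ≤ β := by
    rw [hβ]
    gcongr
    linarith
  have : IsFiniteMeasure (gaussMeasure β) := isFiniteMeasure_gaussMeasure hβ0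
  set m := gaussian β Real.pi with hm
  have hm0 : 0 < m := gaussian_pos _ _
  have hfull := gaussMeasure_le hβ4
  have hout := gaussMeasure_restrict_compl_band_le hβ4
  set S := restrictLp ENNReal.ofReal_ne_top hfull ∘L Tγ with hS
  set R := restrictLp ENNReal.ofReal_ne_top hout ∘L Tγ with hR
  have hSs : ∀ a : EllTwo, HasSum (fun j => a j • expLp (gaussMeasure β) (x j)) (S a) :=
    hrestr _ _ hfull
  have hRs : ∀ a : EllTwo,
      HasSum (fun j => a j • expLp ((gaussMeasure β).restrict bandᶜ) (x j)) (R a) :=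
    hrestr _ _ hout
  have hTae : ∀ a : EllTwo, (T a : ℝ → ℂ) =ᵐ[volume.restrict band] Tγ a := fun a => coeFn_restrictLp ENNReal.ofReal_ne_top hband _
  have hSae : ∀ a : EllTwo, (S a : ℝ → ℂ) =ᵐ[gaussMeasure β] Tγ a := fun a => coeFn_restrictLp ENNReal.ofReal_ne_top hfull _
  have hRae : ∀ a : EllTwo, (R a : ℝ → ℂ) =ᵐ[(gaussMeasure β).restrict bandᶜ] Tγ a :=
    fun a => coeFn_restrictLp ENNReal.ofReal_ne_top hout _
  have hST : ∀ a, m * ‖T a‖ ^ 2 ≤ ‖S a‖ ^ 2 := fun a => by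
    have hle := restrict_band_le_gaussMeasure hβ0.le
    have := norm_sq_le_of_ae_eq (inv_nonneg.2 hm0.le) hle (f := T a) (g := S a)
      ((hTae a).trans ((Measure.absolutelyContinuous_of_le_smul hle).ae_eq (hSae a)).symm)
    rwa [inv_mul_eq_div, le_div_iff₀' hm0] at this
  have hRb : ∀ a, ‖R a‖ ^ 2 ≤ m * (K * m₁⁻¹) * ‖a‖ ^ 2 := fun a => by
    calc ‖R a‖ ^ 2 ≤ m * m₁⁻¹ * ‖Tγ a‖ ^ 2 := norm_sq_le_of_ae_eq (by positivity) hout (hRae a)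
      _ ≤ m * m₁⁻¹ * (K * ‖a‖ ^ 2) := by gcongr; exact hTγb a
      _ = _ := by ring
  have hSlow : ∀ a, m * B⁻¹ ^ 2 * ‖a‖ ^ 2 ≤ ‖S a‖ ^ 2 := fun a => by
    refine le_trans ?_ (hST a)
    rw [mul_assoc, ← mul_pow]
    gcongr
    exact hTlow a
  have hbij := bijective_adjoint_comp_self (by positivity) hSlow
  have hSsum : ∀ (b : EllTwo) (t : ℝ), HasSum
      (fun j => b j * (√(4 * Real.pi * lam) * gaussian lam (t - x j) : ℝ))
      (inner ℂ (expLp (gaussMeasure β) t) (S b)) := fun b t => by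
    have := (hSs b).mapL (innerSL ℂ (expLp (gaussMeasure β) t))
    simp only [map_smul, innerSL_apply_apply, smul_eq_mul] at this
    convert! this using 3 with j
    exact (inner_expLp_expLp hl t (x j)).symm
  have hqr : MemLp q 2 (volume.restrict band) := hq.restrict _
  set Q : L2Band := hqr.toLp q with hQ
  have hTQ : ∀ k, (ContinuousLinearMap.adjoint T Q : EllTwo) k = invFourier q (x k) := fun k => by
    rw [adjoint_apply_of_hasSum hTs, expBand]
    refine (inner_expLp (volume.restrict band) (x k) hqr.coeFn_toLp).trans ?_
    refine setIntegral_eq_integral_of_forall_compl_eq_zero fun u hu => ?_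
    rw [hq0 u hu, zero_mul]
  have hiff : ∀ b : EllTwo, (∀ k, HasSum
        (fun j => b j * (√(4 * Real.pi * lam) * gaussian lam (x k - x j) : ℝ))
        (invFourier q (x k))) ↔
      (ContinuousLinearMap.adjoint S ∘L S) b = ContinuousLinearMap.adjoint T Q := fun b => by
    have e : ∀ k, ((ContinuousLinearMap.adjoint S ∘L S) b : EllTwo) k
        = inner ℂ (expLp (gaussMeasure β) (x k)) (S b) := fun k => by
      rw [ContinuousLinearMap.comp_apply, adjoint_apply_of_hasSum hSs]
    constructor
    · intro h
      ext k
      rw [e, hTQ]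
      exact (hSsum b (x k)).unique (h k)
    · intro h k
      rw [← hTQ, ← h, e]
      exact hSsum b (x k)
  refine ⟨?_, fun b hb => ?_⟩
  · simp only [hiff]
    exact hbij.existsUnique _
  rw [hiff, ContinuousLinearMap.comp_apply] at hb
  set F : ℝ → ℂ := ⇑(Tγ b) with hF
  have hFm : StronglyMeasurable F := Lp.stronglyMeasurable _
  have hFband : MemLp F 2 (volume.restrict band) := (memLp_congr_ae (hTae b)).1 (Lp.memLp _)
  have hFfull : MemLp F 2 (gaussMeasure β) := (memLp_congr_ae (hSae b)).1 (Lp.memLp _)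
  have hψ2 := memLp_gaussian_mul hβ0.le hFband
  set ψ : L2Band := hψ2.toLp _ with hψ
  -- The weighted integral over the line is cut at the band edge; on the band the weight is absorbed
  -- into `ψ`, since `T` lives in unweighted `L²`.
  have hsplit : ContinuousLinearMap.adjoint S (S b)
      = ContinuousLinearMap.adjoint T ψ + ContinuousLinearMap.adjoint R (R b) := by
    ext k
    rw [lp.coeFn_add, Pi.add_apply, adjoint_apply_of_hasSum hSs, adjoint_apply_of_hasSum hTs,
      adjoint_apply_of_hasSum hRs, inner_expLp _ _ (hSae b), inner_expLp _ _ (hRae b)]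
    have h1 : inner ℂ (expBand (x k)) ψ
        = ∫ u in band, F u * Complex.exp (Complex.I * u * x k) ∂(gaussMeasure β) := by
      rw [setIntegral_gaussMeasure _ _ measurableSet_Icc]
      refine (inner_expLp (volume.restrict band) (x k) hψ2.coeFn_toLp).trans ?_
      simp only [mul_assoc]
    have hint : Integrable (fun u => F u * Complex.exp (Complex.I * u * x k)) (gaussMeasure β) := by
      refine (hFfull.integrable one_le_two).mul_bdd (c := 1)
        (by fun_prop : Continuous _).aestronglyMeasurable (.of_forall fun u => ?_)
      rw [Complex.norm_exp]
      simp
    rw [h1, integral_add_compl measurableSet_Icc hint]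
  have hest := energy_estimate hB hm0 (by positivity) hTlow hTup hTsurj hST hRb hb hsplit
  -- The Fourier integral of `G` is the interpolating series; its energy is at most `‖ψ‖² + m‖R
  -- b‖²`.
  set G : ℝ → ℂ := fun u => (gaussian β u : ℂ) * F u with hG
  have hGb : eLpNorm G 2 volume ^ 2 ≤ ENNReal.ofReal
      ((1 + K * m₁⁻¹ * B ^ 4) ^ 2 + K * m₁⁻¹ * B ^ 6) * eLpNorm q 2 volume ^ 2 := by
    have e1 : ∫⁻ u in band, ‖G u‖ₑ ^ 2 = ENNReal.ofReal (‖ψ‖ ^ 2) := by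
      rw [← eLpNorm_two_sq, ← Lp.enorm_toLp hψ2, ← ofReal_norm,
        ENNReal.ofReal_pow (norm_nonneg _)]
    have e2 : ∫⁻ u in bandᶜ, ‖F u‖ₑ ^ 2 ∂(gaussMeasure β) = ENNReal.ofReal (‖R b‖ ^ 2) := by
      rw [← eLpNorm_two_sq, ← eLpNorm_congr_ae (hRae b), ← Lp.enorm_def, ← ofReal_norm,
        ENNReal.ofReal_pow (norm_nonneg _)]
    have e3 : ENNReal.ofReal (‖Q‖ ^ 2) ≤ eLpNorm q 2 volume ^ 2 := by
      rw [ENNReal.ofReal_pow (norm_nonneg _), ofReal_norm, Lp.enorm_toLp]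
      gcongr
      exact Measure.restrict_le_self
    rw [eLpNorm_two_sq]
    refine (lintegral_gaussian_mul_le hβ0.le hFm).trans ?_
    change (∫⁻ u in band, ‖G u‖ₑ ^ 2) + _ ≤ _
    rw [e1, e2, ← ENNReal.ofReal_mul hm0.le, ← ENNReal.ofReal_add (by positivity) (by positivity)]
    refine (ENNReal.ofReal_le_ofReal hest).trans ?_
    rw [ENNReal.ofReal_mul (by positivity)]
    gcongr
  refine ⟨G, ?_, ⟨?_, ?_⟩, hGb, fun t => ?_⟩
  · exact (integrable_gaussMeasure_iff β F).1 (hFfull.integrable one_le_two)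
  · have hg := continuous_gaussian β
    exact (by fun_prop : Continuous fun u => (gaussian β u : ℂ)).aestronglyMeasurable.mul
      hFm.aestronglyMeasurable
  · have := hGb.trans_lt (ENNReal.mul_lt_top ENNReal.ofReal_lt_top (ENNReal.pow_lt_top hq.2))
    by_contra h
    rw [not_lt_top_iff] at h
    rw [h] at this
    simp at this
  · rw [← inner_expLp_gaussMeasure t (hSae b)]
    exact hSsum b t


/-! ### Return to Paley–Wiener functions -/

theorem isInterpCoeff_smul_iff {x : ℤ → ℝ} {lam : ℝ} {f q : ℝ → ℂ}
    (hf : ∀ t, f t = (2 * Real.pi : ℂ)⁻¹ * invFourier q t) (b : EllTwo) :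
    IsInterpCoeff lam x f (((√(4 * Real.pi * lam) : ℂ) * (2 * Real.pi : ℂ)⁻¹) • b : EllTwo) ↔
      ∀ k, HasSum (fun j => b j * (√(4 * Real.pi * lam) * gaussian lam (x k - x j) : ℝ))
        (invFourier q (x k)) := by
  have hp : (2 * Real.pi : ℂ)⁻¹ ≠ 0 := by
    simp
  refine (and_iff_right (lp.memℓp _)).trans (forall_congr' fun k => ?_)
  rw [hf, ← hasSum_mul_left_iff hp (a₁ := invFourier q (x k))]
  refine iff_of_eq (congrArg (HasSum · _) (funext fun j => ?_))
  simp
  ring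

theorem exists_interpolant {x : ℤ → ℝ} (hx : IsRieszBasisSequence x) :
    ∃ C : ℝ, 0 ≤ C ∧ ∀ lam : ℝ, 0 < lam → lam ≤ 1 → ∀ f ∈ PW,
      (∃! a : ℤ → ℂ, IsInterpCoeff lam x f a) ∧
      ∀ a, IsInterpCoeff lam x f a → ∃ J : ℝ → ℂ, Continuous J ∧ MemLp J 2 volume ∧
        eLpNorm J 2 volume ≤ ENNReal.ofReal C * eLpNorm f 2 volume ∧
        ∀ t, HasSum (fun j => a j * (gaussian lam (t - x j) : ℂ)) (J t) := by
  obtain ⟨D, hD, h⟩ := exists_interpolation hx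
  refine ⟨√D, Real.sqrt_nonneg D, fun lam hl hl1 f hf => ?_⟩
  obtain ⟨q, q1, q2, q0, hfq⟩ := exists_invFourier_of_mem_PW hf
  obtain ⟨⟨b, hb, hbu⟩, hG⟩ := h lam hl hl1 q q2 q0
  set κ : ℂ := (√(4 * Real.pi * lam) : ℂ) * (2 * Real.pi : ℂ)⁻¹ with hκ
  have hp : (2 * Real.pi : ℂ)⁻¹ ≠ 0 := by
    simp
  have hs : (√(4 * Real.pi * lam) : ℂ) ≠ 0 := by
    have : 0 < √(4 * Real.pi * lam) := by positivity
    exact_mod_cast this.ne'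
  have hκ0 : κ ≠ 0 := mul_ne_zero hs hp
  have hunique : ∀ a, IsInterpCoeff lam x f a → a = (κ • b : EllTwo) := fun a ha => by
    set a' : EllTwo := ⟨a, ha.1⟩ with ha'
    have e : κ • κ⁻¹ • a' = a' := smul_inv_smul₀ hκ0 a'
    have h1 : IsInterpCoeff lam x f (κ • κ⁻¹ • a' : EllTwo) := by rw [e]; exact ha
    rw [← hbu _ ((isInterpCoeff_smul_iff hfq _).1 h1), e]
  refine ⟨⟨(κ • b : EllTwo), (isInterpCoeff_smul_iff hfq b).2 hb, hunique⟩, fun a ha => ?_⟩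
  obtain ⟨G, G1, G2, hGle, hGs⟩ := hG b hb
  have hle : eLpNorm G 2 volume ≤ ENNReal.ofReal √D * eLpNorm q 2 volume := by
    rw [← ENNReal.pow_le_pow_left_iff two_ne_zero, mul_pow,
      ← ENNReal.ofReal_pow (Real.sqrt_nonneg D), Real.sq_sqrt hD]
    exact hGle
  have hnorm : ∀ {g : ℝ → ℂ}, Integrable g → MemLp g 2 volume →
      eLpNorm (fun t => (2 * Real.pi : ℂ)⁻¹ * invFourier g t) 2 volume
        = ‖(2 * Real.pi : ℂ)⁻¹‖ₑ * ENNReal.ofReal √(2 * Real.pi) * eLpNorm g 2 volume :=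
    fun {g} g1 g2 => by
      rw [mul_assoc, ← eLpNorm_invFourier g1 g2, ← eLpNorm_const_smul]
      rfl
  have hcont : Continuous fun t => (2 * Real.pi : ℂ)⁻¹ * invFourier G t :=
    continuous_const.mul (continuous_invFourier G1)
  refine ⟨_, hcont, ⟨hcont.aestronglyMeasurable, ?_⟩, ?_, fun t => ?_⟩
  · rw [hnorm G1 G2]
    exact ENNReal.mul_lt_top (ENNReal.mul_lt_top enorm_lt_top ENNReal.ofReal_lt_top) G2.2
  -- The same Plancherel factor occurs on both sides, so the constant `√D` survives unchanged.
  · rw [funext hfq, hnorm G1 G2, hnorm q1 q2, mul_left_comm]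
    gcongr
  · rw [hunique a ha]
    refine ((hGs t).mul_left (2 * Real.pi : ℂ)⁻¹).congr_fun fun j => ?_
    simp [hκ]
    ring

theorem isInterpCoeff_interpCoeff {lam : ℝ} {x : ℤ → ℝ} {f : ℝ → ℂ}
    (h : ∃ a, IsInterpCoeff lam x f a) : IsInterpCoeff lam x f (interpCoeff lam x f) := by
  rw [interpCoeff, dif_pos h]
  exact h.choose_spec

theorem IsInterpCoeff.add {lam : ℝ} {x : ℤ → ℝ} {f g : ℝ → ℂ} {a b : ℤ → ℂ}
    (ha : IsInterpCoeff lam x f a) (hb : IsInterpCoeff lam x g b) :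
    IsInterpCoeff lam x (f + g) (a + b) :=
  ⟨ha.1.add hb.1, fun k => by simpa [add_mul] using (ha.2 k).add (hb.2 k)⟩

theorem IsInterpCoeff.const_smul {lam : ℝ} {x : ℤ → ℝ} {f : ℝ → ℂ} {a : ℤ → ℂ}
    (ha : IsInterpCoeff lam x f a) (c : ℂ) : IsInterpCoeff lam x (c • f) (c • a) :=
  ⟨ha.1.const_smul c, fun k => by simpa [mul_assoc] using (ha.2 k).mul_left c⟩

end GaussInterp

end

theorem theoremT (x : ℤ → ℝ) (hx : GaussInterp.IsRieszBasisSequence x) :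
    ∃ C : ℝ, 0 ≤ C ∧ ∀ lam : ℝ, 0 < lam → lam ≤ 1 →
      -- each interpolant is well defined, interpolates, and lies in `C(ℝ) ∩ L₂(ℝ)`
      (∀ f ∈ GaussInterp.PW,
        (∃! a : ℤ → ℂ, GaussInterp.IsInterpCoeff lam x f a) ∧
        (∀ t : ℝ, Summable fun j : ℤ =>
          GaussInterp.interpCoeff lam x f j * (GaussInterp.gaussian lam (t - x j) : ℂ)) ∧
        (∀ k : ℤ, GaussInterp.gaussInterpolant lam x f (x k) = f (x k)) ∧
        Continuous (GaussInterp.gaussInterpolant lam x f) ∧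
        MemLp (GaussInterp.gaussInterpolant lam x f) 2 (volume : Measure ℝ)) ∧
      -- the map is linear on the Paley–Wiener space
      (∀ f ∈ GaussInterp.PW, ∀ g ∈ GaussInterp.PW,
        GaussInterp.gaussInterpolant lam x (f + g) =
          GaussInterp.gaussInterpolant lam x f + GaussInterp.gaussInterpolant lam x g) ∧
      (∀ c : ℂ, ∀ f ∈ GaussInterp.PW,
        GaussInterp.gaussInterpolant lam x (c • f) =
          c • GaussInterp.gaussInterpolant lam x f) ∧
      -- it is bounded from `PW` to `L₂(ℝ)`, with a bound that does not depend on `lam`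
      (∀ f ∈ GaussInterp.PW,
        eLpNorm (GaussInterp.gaussInterpolant lam x f) 2 (volume : Measure ℝ) ≤
          ENNReal.ofReal C * eLpNorm f 2 (volume : Measure ℝ)) := by
  obtain ⟨C, hC, h⟩ := GaussInterp.exists_interpolant hx
  refine ⟨C, hC, fun lam hl hl1 => ?_⟩
  have hcoeff : ∀ f ∈ GaussInterp.PW,
      GaussInterp.IsInterpCoeff lam x f (GaussInterp.interpCoeff lam x f) := fun f hf =>
    GaussInterp.isInterpCoeff_interpCoeff (h lam hl hl1 f hf).1.exists
  have hJ : ∀ f ∈ GaussInterp.PW,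
      Continuous (GaussInterp.gaussInterpolant lam x f) ∧
      MemLp (GaussInterp.gaussInterpolant lam x f) 2 (volume : Measure ℝ) ∧
      eLpNorm (GaussInterp.gaussInterpolant lam x f) 2 (volume : Measure ℝ) ≤
        ENNReal.ofReal C * eLpNorm f 2 (volume : Measure ℝ) ∧
      ∀ t, HasSum (fun j => GaussInterp.interpCoeff lam x f j *
        (GaussInterp.gaussian lam (t - x j) : ℂ)) (GaussInterp.gaussInterpolant lam x f t) := by
    intro f hf
    obtain ⟨J, hJc, hJ2, hJn, hJs⟩ := (h lam hl hl1 f hf).2 _ (hcoeff f hf)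
    have e : GaussInterp.gaussInterpolant lam x f = J := funext fun t => (hJs t).tsum_eq
    rw [e]
    exact ⟨hJc, hJ2, hJn, hJs⟩
  refine ⟨fun f hf => ⟨(h lam hl hl1 f hf).1, fun t => ((hJ f hf).2.2.2 t).summable,
    fun k => ((hcoeff f hf).2 k).tsum_eq, (hJ f hf).1, (hJ f hf).2.1⟩,
    fun f hf g hg => ?_, fun c f hf => ?_, fun f hf => (hJ f hf).2.2.1⟩
  · have hfg := GaussInterp.PW.add_mem hf hg
    -- Coefficients are selected by choice; uniqueness forces the selection to be additive, and
    -- likewise homogeneous below.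
    have e := (h lam hl hl1 _ hfg).1.unique (hcoeff _ hfg) ((hcoeff f hf).add (hcoeff g hg))
    funext t
    have h1 := (hJ _ hfg).2.2.2 t
    rw [e] at h1
    refine h1.unique ?_
    simpa [add_mul] using ((hJ f hf).2.2.2 t).add ((hJ g hg).2.2.2 t)
  · have hcf := GaussInterp.PW.smul_mem c hf
    have e := (h lam hl hl1 _ hcf).1.unique (hcoeff _ hcf) ((hcoeff f hf).const_smul c)
    funext t
    have h1 := (hJ _ hcf).2.2.2 t
    rw [e] at h1
    refine h1.unique ?_
    simpa [mul_assoc] using ((hJ f hf).2.2.2 t).mul_left c
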